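/- Let $B=\{0,1\}$, let $B^*$ be the set of finite binary words, and let $|w|$ be the length of $w\in B^*$. For a machine $\zeta$ (a partial computable function from $B^*$ to $B^*$) put $C_\zeta(A)=\min\{|p| : \zeta(p)=A\}$ (with $\min\emptyset=\infty$). Fix an optimal machine $\zeta$, i.e. one such that for every machine $\zeta'$ there is a constant $c_{\zeta'}$ with $C_\zeta(A)\le C_{\zeta'}(A)+c_{\zeta'}$ for all $A\in B^*$, and let $C=C_\zeta$ be plain Kolmogorov complexity. An ideal code is an injective map $\varphi:B^*\to B^*$ for which there is a constant $c$ with $|\varphi(A)|\le C(A)+c$ for all $A\in B^*$. Let $F_X,F_Y$ be Borel probability distributions on $\mathbb R^d$, $d\ge 1$, and let $X_1,\dots,X_m\sim F_X$ and $Y_1,\dots,Y_k\sim F_Y$ be independent, within the samples and jointly. The word $A=A_1\cdots A_{m+k}$ is defined as follows. If $d=1$, order the joint sample as $Z_1\le\dots\le Z_{m+k}$ and put $A_i=0$ if $Z_i$ is from the first sample and $A_i=1$ if it is from the second. For each group of equal values, containing $m'$ elements of the first sample and $k'$ of the second, the corresponding part of $A$ is chosen uniformly at random among the $\frac{(m'+k')!}{m'!\,k'!}$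 words with $m'$ zeros and $k'$ ones, independently for different groups. If $d>1$, first replace each sample vector $x=(x^1,\dots,x^d)$ by the sequence $\tau(x)=(x^{10},\dots,x^{d0},x^{11},\dots,x^{d1},x^{12},\dots,x^{d2},\dots)$, where $x^{i0}=\lfloor x^i\rfloor$ and $x^{i1},x^{i2},\dots$ are the binary digits of the fractional part $x^i-\lfloor x^i\rfloor$ (when there are two expansions, the one ending in zeros), and then proceed as for $d=1$, with these sequences ordered lexicographically. For $\alpha>0$, the test $G_\varphi$ at significance level $\alpha$ rejects the hypothesis $F_X=F_Y$ if $|\varphi(A)|\le\log_2(\alpha N)$, where $N=\frac{(m+k)!}{m!\,k!}$, and accepts it otherwise. Then for every ideal code $\varphi$, every $\alpha>0$, every $d\ge1$, every pair of distributions $F_X\ne F_Y$ on $\mathbb R^d$ and all $0<a<b<1$, the probability that $G_\varphi$ accepts tends to $0$ as $m,k\to\infty$ with $a<\frac km<b$. -/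

import Mathlib

open MeasureTheory Filter Topology
open scoped ENNReal

noncomputable section

namespace RankTest

/-! ### Kolmogorov complexity and codes

Binary words are `List Bool`, with `false` for the letter `0` and `true` for the letter `1`. A Turing
machine is represented by the partial computable function from words to words that it computes. -/

/-- The complexity of the word `A` with respect to the machine `ζ`: the least length of a program `p`
on which `ζ` halts with output `A` (and `⊤` if there is no such program). -/
def complexity (ζ : List Bool →. List Bool) (A : List Bool) : ℕ∞ :=
  ⨅ (p : List Bool) (_ : A ∈ ζ p), (p.length : ℕ∞)

/-- `ζ` is an optimal machine: up to an additive constant, no machine gives smaller complexities. -/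
def IsOptimalMachine (ζ : List Bool →. List Bool) : Prop :=
  Partrec ζ ∧
    ∀ ζ' : List Bool →. List Bool, Partrec ζ' →
      ∃ c : ℕ, ∀ A : List Bool, complexity ζ A ≤ complexity ζ' A + c

/-- A code is an injective map from binary words to binary words. -/
def IsCode (φ : List Bool → List Bool) : Prop :=
  Function.Injective φ

/-- An ideal code, where complexity is measured by the machine `ζ`: a code that compresses every word
up to its complexity, with a constant excess. -/
def IsIdealCode (ζ : List Bool →. List Bool) (φ : List Bool → List Bool) : Prop :=
  IsCode φ ∧ ∃ c : ℕ, ∀ A : List Bool, ((φ A).length : ℕ∞) ≤ complexity ζ A + c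

/-! ### The word of two samples -/

section Word

variable {S : Type*} [LinearOrder S] {m k : ℕ}

/-- The ways to list the joint sample `x₁, …, xₘ, y₁, …, yₖ` in nondecreasing order: `σ i` says which
element stands in position `i`. -/
def orderings (x : Fin m → S) (y : Fin k → S) : Finset (Fin (m + k) ≃ Fin m ⊕ Fin k) :=
  open Classical in Finset.univ.filter fun σ => Monotone fun i => Sum.elim x y (σ i)

/-- The words read off from the orderings of the joint sample, with the letter `0` (`false`) for an
element of the first sample and `1` (`true`) for an element of the second. Reordering the elements of
a group of ties, with `m'` elements of the first and `k'` of the second sample, produces in the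
positions of that group exactly all words with `m'` zeros and `k'` ones. -/
def jointWords (x : Fin m → S) (y : Fin k → S) : Finset (List Bool) :=
  (orderings x y).image fun σ => List.ofFn fun i => (σ i).isRight

theorem orderings_nonempty (x : Fin m → S) (y : Fin k → S) : (orderings x y).Nonempty := by
  refine ⟨(Tuple.sort fun i => Sum.elim x y (finSumFinEquiv.symm i)).trans finSumFinEquiv.symm, ?_⟩
  simp only [orderings, Finset.mem_filter, Finset.mem_univ, true_and]
  exact Tuple.monotone_sort fun i => Sum.elim x y (finSumFinEquiv.symm i)

theorem jointWords_nonempty (x : Fin m → S) (y : Fin k → S) : (jointWords x y).Nonempty :=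
  (orderings_nonempty x y).image _

/-- The law of the random word `A` of two given samples. Each group of ties is filled in uniformly at
random, independently of the other groups, so `A` is uniform on `jointWords x y`. -/
def wordLaw (x : Fin m → S) (y : Fin k → S) : PMF (List Bool) :=
  PMF.uniformOfFinset (jointWords x y) (jointWords_nonempty x y)

end Word

/-! ### The reduction to one dimension -/

/-- The binary expansion of a real number: first its integer part `⌊r⌋`, then the binary digits of its
fractional part (for dyadic rationals, the digits that end in zeros). -/
def binaryExpansion (r : ℝ) : ℕ → ℤ
  | 0 => ⌊r⌋
  | j + 1 => ((Real.digits (Int.fract r) 2 j : Fin 2) : ℕ)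

/-- The map `τ`: interleaving of the binary expansions of the components of a vector. The `n`-th term
is entry `n / d` of the expansion of component `n % d`. Sequences are ordered lexicographically. -/
def interleave (d : ℕ) [NeZero d] (x : Fin d → ℝ) : Lex (ℕ → ℤ) :=
  toLex fun n => binaryExpansion (x (Fin.ofNat d n)) (n / d)

/-! ### The test -/

/-- The test, applied to the word `A` of samples of sizes `m` and `k`, rejects the hypothesis of
homogeneity at significance level `α`; it accepts otherwise. -/
def Rejects (φ : List Bool → List Bool) (α : ℝ) (m k : ℕ) (A : List Bool) : Prop :=
  ((φ A).length : ℝ) ≤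
    Real.logb 2 (α * (((m + k).factorial : ℝ) / ((m.factorial : ℝ) * (k.factorial : ℝ))))

/-- The probability that the test accepts, for independent samples of sizes `m` and `k`, i.i.d. with
distributions `FX` and `FY` on `E`, when sample elements are compared through `τ : E → S`. -/
def acceptProb {E S : Type*} [MeasurableSpace E] [LinearOrder S] (τ : E → S)
    (φ : List Bool → List Bool) (α : ℝ) (FX FY : Measure E) (m k : ℕ) : ℝ≥0∞ :=
  ∫⁻ s : (Fin m → E) × (Fin k → E),
    (wordLaw (fun i => τ (s.1 i)) (fun i => τ (s.2 i))).toOuterMeasure {A | ¬ Rejects φ α m k A}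
    ∂((Measure.pi fun _ : Fin m => FX).prod (Measure.pi fun _ : Fin k => FY))

/-- Sample sizes `(m, k)` tending to infinity with `a < k / m < b`. -/
def sampleSizes (a b : ℝ) : Filter (ℕ × ℕ) :=
  (atTop ×ˢ atTop) ⊓ 𝓟 {p | a < (p.2 : ℝ) / (p.1 : ℝ) ∧ (p.2 : ℝ) / (p.1 : ℝ) < b}

end RankTest

end

/-! Two different distributions give different masses to some measurable lower set `H` of the sample
order. Whatever the tie-breaking, elements with equal keys lie on the same side of `H`, so every
word of the joint sample is a concatenation `u ++ v`: the letters of the elements in `H`, then the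
others. If `i` and `j` elements of the two samples fall in `H`, then `u` has `i + j` letters with
`j` ones, and `v` has the remaining `m - i` zeros and `k - j` ones.

A machine can rebuild the word from the shapes of `u` and `v` and their ranks among the words of
these shapes (`exists_complexity_append_le`). Hence the code length is at most `log₂ R + 8 log₂ (m +
k + 1) + O(1)`, where `R` is the product of the two binomial coefficients that count words of these
shapes. With `N` the number of all words with `m` zeros and `k` ones, the ratio `R / N` equals
`C(m,i) C(k,j) / C(m+k,i+j)` (`choose_trinomial`), a hypergeometric probability.

By Chebyshev's inequality, `i / m` and `j / k` are, with probability tending to one, close to the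
two different masses of `H`. Such a disproportionate Vandermonde term is exponentially small in `k`
relative to the whole sum (`choose_mul_choose_mul_pow_le`). The bounds on `k / m` keep `m` and `k`
comparable, so this gain beats the polynomial overhead, the constants and `α`, and the test rejects.
-/

namespace RankTest

/-! ### Complexity bounds from injective numberings -/

/-- The positive number whose binary digits, below the leading one, form the given word. -/
def wordNumber (p : List Bool) : ℕ :=
  p.foldr (fun b v => 2 * v + b.toNat) 1

/-- The binary digits of `v` below the leading one are a program of length at most `log₂ v`. -/
theorem exists_wordNumber_eq (v : ℕ) (hv : v ≠ 0) :
    ∃ p, wordNumber p = v ∧ 2 ^ p.length ≤ v := by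
  induction v using Nat.strong_induction_on with
  | _ v ih =>
    rcases Nat.lt_or_ge v 2 with h | h
    · exact ⟨[], by simp [wordNumber]; omega, by simp; omega⟩
    · obtain ⟨p, hp, hl⟩ := ih (v / 2) (by omega) (by omega)
      refine ⟨decide (v % 2 = 1) :: p, ?_, ?_⟩
      · have hc : wordNumber (decide (v % 2 = 1) :: p) =
          2 * wordNumber p + (decide (v % 2 = 1)).toNat := rfl
        rw [hc, hp]
        by_cases h2 : v % 2 = 1 <;> simp [h2] <;> omega
      · rw [List.length_cons, pow_succ]; omega

theorem primrec_toNat : Primrec Bool.toNat := Primrec.dom_finite _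

theorem primrec_wordNumber : Primrec wordNumber := by
  refine Primrec.list_foldr (f := id) (g := fun _ => 1)
    (h := fun _ (q : Bool × ℕ) => 2 * q.2 + q.1.toNat) Primrec.id (Primrec.const 1) ?_
  refine Primrec.nat_add.comp (Primrec.nat_mul.comp (Primrec.const 2) ?_) ?_
  · exact Primrec.snd.comp Primrec.snd
  · exact primrec_toNat.comp (Primrec.fst.comp Primrec.snd)

/-- A computable numbering `G` of descriptions of words, where `0` marks the void descriptions, bounds
the complexity of the word with description `u` by the logarithm of `G u`. -/
theorem exists_complexity_le_of_numbering {ζ : List Bool →. List Bool} (hζ : IsOptimalMachine ζ)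
    {γ : Type*} [Primcodable γ] (G : γ → ℕ) (h : γ → List Bool) (hG : Computable G)
    (hh : Computable h) (inj : ∀ u u', G u ≠ 0 → G u = G u' → h u = h u') :
    ∃ c : ℕ, ∀ u, G u ≠ 0 → ∃ L : ℕ, 2 ^ L ≤ G u ∧ complexity ζ (h u) ≤ (L : ℕ∞) + c := by
  -- The machine reads its program as a number and searches all descriptions for one with that value
  -- of `G`.
  let f : List Bool → ℕ → Option (List Bool) := fun p n =>
    (Encodable.decode (α := γ) n).bind fun u => if G u = wordNumber p then some (h u) else none
  have hf : Computable₂ f := by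
    refine Computable.option_bind (Computable.decode.comp Computable.snd) ?_
    have h1 : Computable fun x : (List Bool × ℕ) × γ => decide (G x.2 = wordNumber x.1.1) :=
      (Primrec.eq.decide.to_comp).comp (hG.comp Computable.snd)
        (primrec_wordNumber.to_comp.comp (Computable.fst.comp Computable.fst))
    refine (Computable.cond h1 (Computable.option_some.comp (hh.comp Computable.snd))
      (Computable.const none)).of_eq ?_
    intro x
    by_cases hx : G x.2 = wordNumber x.1.1 <;> simp [hx]
  obtain ⟨c, hc⟩ := hζ.2 (fun p => Nat.rfindOpt (f p)) (Partrec.rfindOpt hf)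
  refine ⟨c, fun u hu => ?_⟩
  obtain ⟨p, hp, hl⟩ := exists_wordNumber_eq (G u) hu
  refine ⟨p.length, hl, (hc (h u)).trans ?_⟩
  gcongr
  refine iInf₂_le p ?_
  -- The search halts because `u` itself qualifies. It may stop at another description, but `inj`
  -- then gives the same word.
  have hdom : (Nat.rfindOpt (f p)).Dom :=
    Nat.rfindOpt_dom.2 ⟨Encodable.encode u, h u, by simp [f, hp]⟩
  obtain ⟨n, hn⟩ := Nat.rfindOpt_spec (Part.get_mem hdom)
  have : (Nat.rfindOpt (f p)).get hdom = h u := by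
    simp only [f, Option.mem_def, Option.bind_eq_some_iff] at hn
    obtain ⟨u', -, hu'⟩ := hn
    split_ifs at hu' with h1
    · rw [← Option.some.inj hu']
      exact (inj u u' hu (by rw [h1, hp])).symm
  exact this ▸ Part.get_mem hdom

/-! ### Enumerative coding -/

theorem primrec_factorial : Primrec Nat.factorial := by
  refine (Primrec.nat_rec₁ (f := fun n r => (n + 1) * r) 1
    (Primrec.nat_mul.comp (Primrec.succ.comp Primrec.fst) Primrec.snd)).of_eq fun n => ?_
  induction n with
  | zero => rfl
  | succ n ih => simp only [Nat.factorial_succ]; rw [← ih]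

theorem primrec_choose : Primrec₂ Nat.choose := by
  have h : Primrec fun q : ℕ × ℕ => if q.2 ≤ q.1 then
      q.1.factorial / (q.2.factorial * (q.1 - q.2).factorial) else 0 := by
    refine Primrec.ite (Primrec.nat_le.comp Primrec.snd Primrec.fst) ?_ (Primrec.const 0)
    refine Primrec.nat_div.comp (primrec_factorial.comp Primrec.fst) (Primrec.nat_mul.comp ?_ ?_)
    · exact primrec_factorial.comp Primrec.snd
    · exact primrec_factorial.comp (Primrec.nat_sub.comp Primrec.fst Primrec.snd)
  refine h.of_eq fun q => ?_
  split_ifs with hq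
  · exact (Nat.choose_eq_factorial_div_factorial hq).symm
  · exact (Nat.choose_eq_zero_of_lt (by omega)).symm

theorem primrec_pow : Primrec₂ ((· ^ ·) : ℕ → ℕ → ℕ) :=
  Primrec₂.unpaired'.1 Nat.Primrec.pow

/-- The length of a word, the number of its ones, and its rank among the words with the same length
and number of ones. -/
def rankData (w : List Bool) : ℕ × ℕ × ℕ :=
  w.foldr (fun b s => (s.1 + 1, s.2.1 + b.toNat, s.2.2 + b.toNat * s.1.choose (s.2.1 + 1))) (0, 0, 0)

theorem rankData_cons (b : Bool) (w : List Bool) :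
    rankData (b :: w) = ((rankData w).1 + 1, (rankData w).2.1 + b.toNat,
      (rankData w).2.2 + b.toNat * (rankData w).1.choose ((rankData w).2.1 + 1)) := rfl

theorem rankData_length (w : List Bool) : (rankData w).1 = w.length := by
  induction w with
  | nil => rfl
  | cons b w ih => rw [rankData_cons, List.length_cons, ih]

theorem rankData_count (w : List Bool) : (rankData w).2.1 = w.count true := by
  induction w with
  | nil => rfl
  | cons b w ih => rw [rankData_cons, List.count_cons, ih]; cases b <;> simp

/-- Pascal's rule: among the words of length `n + 1` with `k + 1` ones, those that begin with `0`
take the ranks below `C(n, k + 1)`, and those that begin with `1` the next `C(n, k)`. -/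
theorem rankData_rank_lt (w : List Bool) :
    (rankData w).2.2 < (rankData w).1.choose (rankData w).2.1 := by
  induction w with
  | nil => simp [rankData]
  | cons b w ih =>
    rw [rankData_cons]
    cases b
    · simp only [Bool.toNat_false, add_zero, zero_mul]
      exact ih.trans_le (Nat.choose_le_choose _ (Nat.le_succ _))
    · simp only [Bool.toNat_true, one_mul]
      rw [Nat.choose_succ_succ]
      simpa using ih

theorem rankData_injective : Function.Injective rankData := by
  intro w
  induction w with
  | nil =>
    intro w' h
    have := congrArg Prod.fst h
    rw [rankData_length, rankData_length] at this
    exact (List.length_eq_zero_iff.1 this.symm).symm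
  | cons b w ih =>
    intro w' h
    cases w' with
    | nil =>
      have := congrArg Prod.fst h
      rw [rankData_length, rankData_length] at this
      simp at this
    | cons b' w' =>
      have h1 := rankData_rank_lt w
      have h2 := rankData_rank_lt w'
      -- Words of one shape with different first letters have ranks in disjoint intervals.
      have key : ∀ n k k' r r' : ℕ, r < n.choose k → r' < n.choose k' → k' = k + 1 →
          r' ≠ r + n.choose (k + 1) := by
        rintro n k k' r r' - h2 rfl; omega
      simp only [rankData_cons, Prod.mk.injEq] at h
      obtain ⟨hn, hk, hr⟩ := h
      have hn' : (rankData w).1 = (rankData w').1 := by omega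
      have hb : b = b' := by
        cases b <;> cases b' <;> simp only [Bool.toNat_true, Bool.toNat_false, add_zero, zero_mul,
          one_mul] at hk hr ⊢
        · rw [hn'] at h1
          exact (key _ _ _ _ _ h2 h1 hk hr).elim
        · rw [hn'] at h1 hr
          exact (key _ _ _ _ _ h1 h2 hk.symm hr.symm).elim
      subst hb
      have hk' : (rankData w).2.1 = (rankData w').2.1 := by omega
      rw [hn', hk'] at hr
      rw [ih (Prod.ext hn' (Prod.ext hk' (by omega)))]

theorem primrec_rankData : Primrec rankData := by
  refine Primrec.list_foldr (f := id) (g := fun _ => ((0, 0, 0) : ℕ × ℕ × ℕ))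
    (h := fun _ (q : Bool × ℕ × ℕ × ℕ) => (q.2.1 + 1, q.2.2.1 + q.1.toNat,
      q.2.2.2 + q.1.toNat * q.2.1.choose (q.2.2.1 + 1))) Primrec.id (Primrec.const _) ?_
  have hb : Primrec fun x : List Bool × Bool × ℕ × ℕ × ℕ => x.2.1.toNat :=
    primrec_toNat.comp (Primrec.fst.comp Primrec.snd)
  have hs : Primrec fun x : List Bool × Bool × ℕ × ℕ × ℕ => x.2.2 :=
    Primrec.snd.comp Primrec.snd
  have hn := Primrec.fst.comp hs
  have hk := Primrec.fst.comp (Primrec.snd.comp hs)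
  have hr := Primrec.snd.comp (Primrec.snd.comp hs)
  exact Primrec.pair (Primrec.succ.comp hn) (Primrec.pair (Primrec.nat_add.comp hk hb)
    (Primrec.nat_add.comp hr (Primrec.nat_mul.comp hb
      (primrec_choose.comp hn (Primrec.succ.comp hk)))))

/-- The lengths and the numbers of ones of two words, as one number. -/
def pairShape (u : List Bool × List Bool) : ℕ :=
  Nat.pair (Nat.pair (rankData u.1).1 (rankData u.1).2.1)
    (Nat.pair (rankData u.2).1 (rankData u.2).2.1)

/-- The rank of a pair of words among the pairs of the same shape. -/
def pairRank (u : List Bool × List Bool) : ℕ :=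
  (rankData u.1).2.2 + (rankData u.1).1.choose (rankData u.1).2.1 * (rankData u.2).2.2

/-- A number that determines a pair of words, if the shape of the pair is below `2 ^ u.2`. -/
def pairNumber (u : (List Bool × List Bool) × ℕ) : ℕ :=
  if pairShape u.1 < 2 ^ u.2 then 2 ^ u.2 * (2 * (2 ^ u.2 * pairRank u.1 + pairShape u.1) + 1) else 0

theorem pairRank_lt (u : List Bool × List Bool) :
    pairRank u < (rankData u.1).1.choose (rankData u.1).2.1 *
      (rankData u.2).1.choose (rankData u.2).2.1 := by
  have h1 := rankData_rank_lt u.1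
  have h2 := rankData_rank_lt u.2
  calc pairRank u < (rankData u.1).1.choose (rankData u.1).2.1 * ((rankData u.2).2.2 + 1) := by
        rw [pairRank, mul_add]; omega
    _ ≤ _ := Nat.mul_le_mul_left _ h2

theorem pair_ext_of_shape_rank {u u' : List Bool × List Bool} (hs : pairShape u = pairShape u')
    (hr : pairRank u = pairRank u') : u = u' := by
  simp only [pairShape, Nat.pair_eq_pair] at hs
  obtain ⟨⟨h1, h2⟩, h3, h4⟩ := hs
  have a1 := rankData_rank_lt u.1
  have a2 := rankData_rank_lt u'.1
  simp only [pairRank] at hr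
  rw [h1, h2] at hr a1
  have hm := congrArg (· % (rankData u'.1).1.choose (rankData u'.1).2.1) hr
  have hd := congrArg (· / (rankData u'.1).1.choose (rankData u'.1).2.1) hr
  simp only [Nat.add_mul_mod_self_left, Nat.mod_eq_of_lt a1, Nat.mod_eq_of_lt a2] at hm
  simp only [Nat.add_mul_div_left _ _ (Nat.zero_lt_of_lt a2), Nat.div_eq_of_lt a1,
    Nat.div_eq_of_lt a2, zero_add] at hd
  exact Prod.ext (rankData_injective (Prod.ext h1 (Prod.ext h2 hm)))
    (rankData_injective (Prod.ext h3 (Prod.ext h4 hd)))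

theorem two_pow_mul_odd_inj {s t x y : ℕ} (h : 2 ^ s * (2 * x + 1) = 2 ^ t * (2 * y + 1)) :
    s = t ∧ x = y := by
  induction s generalizing t with
  | zero =>
    cases t with
    | zero => simp at h; simp [h]
    | succ t =>
      have : 2 ^ (t + 1) * (2 * y + 1) = 2 * (2 ^ t * (2 * y + 1)) := by ring
      omega
  | succ s ih =>
    cases t with
    | zero =>
      have : 2 ^ (s + 1) * (2 * x + 1) = 2 * (2 ^ s * (2 * x + 1)) := by ring
      omega
    | succ t =>
      have := ih (t := t) (by rw [pow_succ, pow_succ] at h; linarith)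
      omega

/-- The exact power of two reveals the exponent `s`. What remains of the odd part after removing its
last binary digit is split by division by `2 ^ s` into rank (quotient) and shape (remainder). The
price of this separation is a factor of order `2 ^ (2 * s)` over the rank alone. -/
theorem pairNumber_inj (u u' : (List Bool × List Bool) × ℕ) (h0 : pairNumber u ≠ 0)
    (h : pairNumber u = pairNumber u') : u.1 = u'.1 := by
  have h0' := h ▸ h0
  unfold pairNumber at h h0 h0'
  have h1 : pairShape u.1 < 2 ^ u.2 := by by_contra hn; exact h0 (if_neg hn)
  have h2 : pairShape u'.1 < 2 ^ u'.2 := by by_contra hn; exact h0' (if_neg hn)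
  rw [if_pos h1, if_pos h2] at h
  obtain ⟨hs, hv⟩ := two_pow_mul_odd_inj h
  rw [hs] at hv h1
  have hm := congrArg (· % 2 ^ u'.2) hv
  have hd := congrArg (· / 2 ^ u'.2) hv
  simp only [Nat.mul_add_mod, Nat.mod_eq_of_lt h1, Nat.mod_eq_of_lt h2] at hm
  simp only [Nat.mul_add_div (Nat.two_pow_pos u'.2), Nat.div_eq_of_lt h1, Nat.div_eq_of_lt h2,
    add_zero] at hd
  exact pair_ext_of_shape_rank hm hd

theorem primrec_pairNumber : Primrec pairNumber := by
  have a1 : Primrec fun u : (List Bool × List Bool) × ℕ => rankData u.1.1 :=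
    primrec_rankData.comp (Primrec.fst.comp Primrec.fst)
  have a2 : Primrec fun u : (List Bool × List Bool) × ℕ => rankData u.1.2 :=
    primrec_rankData.comp (Primrec.snd.comp Primrec.fst)
  have n1 := Primrec.fst.comp a1
  have n2 := Primrec.fst.comp a2
  have k1 := Primrec.fst.comp (Primrec.snd.comp a1)
  have k2 := Primrec.fst.comp (Primrec.snd.comp a2)
  have r1 := Primrec.snd.comp (Primrec.snd.comp a1)
  have r2 := Primrec.snd.comp (Primrec.snd.comp a2)
  have hs : Primrec fun u : (List Bool × List Bool) × ℕ => pairShape u.1 :=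
    Primrec₂.natPair.comp (Primrec₂.natPair.comp n1 k1) (Primrec₂.natPair.comp n2 k2)
  have hr : Primrec fun u : (List Bool × List Bool) × ℕ => pairRank u.1 :=
    Primrec.nat_add.comp r1 (Primrec.nat_mul.comp (primrec_choose.comp n1 k1) r2)
  have hp : Primrec fun u : (List Bool × List Bool) × ℕ => 2 ^ u.2 :=
    primrec_pow.comp (Primrec.const 2) Primrec.snd
  refine Primrec.ite (Primrec.nat_lt.comp hs hp) ?_ (Primrec.const 0)
  exact Primrec.nat_mul.comp hp (Primrec.succ.comp (Primrec.nat_mul.comp (Primrec.const 2)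
    (Primrec.nat_add.comp (Primrec.nat_mul.comp hp hr) hs)))

/-- Each of the two nested levels of `Nat.pair` squares the bound, hence the fourth power. -/
theorem pairShape_lt (u : List Bool × List Bool) :
    pairShape u < (u.1.length + u.2.length + 1) ^ 4 := by
  have hp : ∀ a b n, a ≤ n → b ≤ n → Nat.pair a b < (n + 1) ^ 2 := fun a b n ha hb =>
    (Nat.pair_lt_max_add_one_sq a b).trans_le (Nat.pow_le_pow_left (by simp [ha, hb]) 2)
  have c1 := List.count_le_length (a := true) (l := u.1)
  have c2 := List.count_le_length (a := true) (l := u.2)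
  set n := u.1.length + u.2.length with hn
  have h1 : Nat.pair (rankData u.1).1 (rankData u.1).2.1 < (n + 1) ^ 2 :=
    hp _ _ _ (by rw [rankData_length]; omega) (by rw [rankData_count]; omega)
  have h2 : Nat.pair (rankData u.2).1 (rankData u.2).2.1 < (n + 1) ^ 2 :=
    hp _ _ _ (by rw [rankData_length]; omega) (by rw [rankData_count]; omega)
  have h3 := hp _ _ ((n + 1) ^ 2 - 1) (Nat.le_sub_one_of_lt h1) (Nat.le_sub_one_of_lt h2)
  have hpos : 0 < (n + 1) ^ 2 := by positivity
  rw [Nat.sub_add_cancel hpos, ← pow_mul] at h3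
  exact h3

theorem pairNumber_bound {p r e R M : ℕ} (hr : r < R) (he : e < p) (hp : p ≤ 2 * M) :
    p * (2 * (p * r + e) + 1) ≤ 8 * R * M ^ 2 := by
  have h : p * (r + 1) ≤ p * R := Nat.mul_le_mul_left _ hr
  rw [mul_add] at h
  calc p * (2 * (p * r + e) + 1) ≤ p * (2 * (p * R)) := Nat.mul_le_mul_left _ (by omega)
    _ ≤ (2 * M) * (2 * ((2 * M) * R)) := by gcongr
    _ = _ := by ring

/-- A concatenation of two words is described by its two parts, of which the ranks among the words of
the same length and number of ones have to be specified, at logarithmic further cost. -/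
theorem exists_complexity_append_le {ζ : List Bool →. List Bool} (hζ : IsOptimalMachine ζ) :
    ∃ c : ℕ, ∀ u v : List Bool, ∃ L : ℕ,
      2 ^ L ≤ 8 * (u.length.choose (u.count true) * v.length.choose (v.count true)) *
        (u.length + v.length + 1) ^ 8 ∧
      complexity ζ (u ++ v) ≤ (L : ℕ∞) + c := by
  obtain ⟨c, hc⟩ := exists_complexity_le_of_numbering hζ pairNumber (fun u => u.1.1 ++ u.1.2)
    primrec_pairNumber.to_comp (Primrec.list_append.comp (Primrec.fst.comp Primrec.fst)
      (Primrec.snd.comp Primrec.fst)).to_comp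
    (fun u u' h0 h => by rw [pairNumber_inj u u' h0 h])
  refine ⟨c, fun u v => ?_⟩
  have hlt := pairShape_lt (u, v)
  obtain ⟨M, hM⟩ : ∃ M, M = (u.length + v.length + 1) ^ 4 := ⟨_, rfl⟩
  obtain ⟨s, h1, h2⟩ : ∃ s, M < 2 ^ s ∧ 2 ^ s ≤ 2 * M := by
    -- This is the least power of two above `M`. As it is at most `2 * M`, the two factors `2 ^ s`
    -- in the number of the pair cost only `O(M ^ 2)`, which is the eighth power in the bound.
    refine ⟨Nat.log 2 M + 1, Nat.lt_pow_succ_log_self one_lt_two M, ?_⟩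
    rw [pow_succ, mul_comm]
    exact Nat.mul_le_mul_left 2 (Nat.pow_log_le_self 2 (by rw [hM]; positivity))
  rw [← hM] at hlt
  have hshape : pairShape (u, v) < 2 ^ s := hlt.trans h1
  have hrank := pairRank_lt (u, v)
  simp only [rankData_length, rankData_count] at hrank
  have hG : pairNumber ((u, v), s) =
      2 ^ s * (2 * (2 ^ s * pairRank (u, v) + pairShape (u, v)) + 1) := if_pos hshape
  have hne : pairNumber ((u, v), s) ≠ 0 := by
    rw [hG]; exact Nat.mul_ne_zero (Nat.two_pow_pos s).ne' (Nat.succ_ne_zero _)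
  obtain ⟨L, hL, hcomp⟩ := hc ((u, v), s) hne
  refine ⟨L, hL.trans ?_, hcomp⟩
  rw [hG]
  refine (pairNumber_bound hrank hshape h2).trans_eq ?_
  rw [hM, ← pow_mul]

/-! ### Binomial coefficients far from proportionality -/

theorem choose_mul_choose_le_add_choose (m k i j : ℕ) :
    m.choose i * k.choose j ≤ (m + k).choose (i + j) := by
  rw [Nat.add_choose_eq]
  refine Finset.single_le_sum (f := fun ij : ℕ × ℕ => m.choose ij.1 * k.choose ij.2) (a := (i, j))
    (fun _ _ => Nat.zero_le _) ?_
  simp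

/-- The terms of Vandermonde's sum increase geometrically towards the proportional ones, so that a term
that is `t` steps away from near-proportionality is exponentially smaller than the sum. -/
theorem choose_mul_choose_mul_pow_le {m k : ℕ} {ε : ℝ} (hε : 0 < ε)
    (hmk : (m + k + 1 : ℝ) ≤ ε / 4 * (m * k)) (hm : 1 ≤ m) (hk : 1 ≤ k) :
    ∀ t i j : ℕ, i ≤ m → j ≤ k → ε / 2 * (m * k) + t * (m + k) ≤ (i * k - j * m : ℝ) →
      (m.choose i * k.choose j : ℝ) * (1 + ε / 16) ^ t ≤ (m + k).choose (i + j) := by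
  intro t
  have hm' : (1 : ℝ) ≤ m := by exact_mod_cast hm
  have hk' : (1 : ℝ) ≤ k := by exact_mod_cast hk
  induction t with
  | zero =>
    intro i j _ _ _
    simpa using mod_cast choose_mul_choose_le_add_choose m k i j
  | succ t ih =>
    intro i j hi hj h
    have hi' : (i : ℝ) ≤ m := by exact_mod_cast hi
    have hj' : (j : ℝ) ≤ k := by exact_mod_cast hj
    have hmkpos : (0 : ℝ) < m * k := by positivity
    push_cast at h
    have hgap : ε / 2 * (m * k) ≤ (i * k - j * m : ℝ) := by
      have : (0 : ℝ) ≤ (t + 1) * (m + k) := by positivity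
      linarith
    have hpos : (0 : ℝ) < i * k - j * m := lt_of_lt_of_le (by positivity) hgap
    obtain ⟨i, rfl⟩ : ∃ i', i = i' + 1 := by
      refine Nat.exists_eq_succ_of_ne_zero ?_
      rintro rfl
      have : (0 : ℝ) ≤ j * m := by positivity
      simp at hpos
      linarith
    have hjk : j < k := by
      rcases hj.lt_or_eq with h1 | rfl
      · exact h1
      · nlinarith
    push_cast at *
    -- Passing from `(i + 1, j)` to `(i, j + 1)` keeps the sum of the indices and lowers the
    -- deviation by exactly `m + k`, the price of one step of `t`.
    have hstep := ih i (j + 1) (by omega) (by omega) (by push_cast; linarith)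
    rw [show i + (j + 1) = i + 1 + j by ring] at hstep
    refine le_trans ?_ hstep
    rw [pow_succ, mul_comm _ (1 + ε / 16), ← mul_assoc]
    refine mul_le_mul_of_nonneg_right ?_ (by positivity)
    have e1 : (m.choose (i + 1) * (i + 1) : ℝ) = m.choose i * (m - i) := by
      have := Nat.choose_succ_right_eq m i
      have h2 : ((m - i : ℕ) : ℝ) = m - i := Nat.cast_sub (by omega)
      rw [← h2]; exact_mod_cast this
    have e2 : (k.choose (j + 1) * (j + 1) : ℝ) = k.choose j * (k - j) := by
      have := Nat.choose_succ_right_eq k j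
      have h2 : ((k - j : ℕ) : ℝ) = k - j := Nat.cast_sub hj
      rw [← h2]; exact_mod_cast this
    have hmi : (0 : ℝ) < m - i := by
      have : (i : ℝ) + 1 ≤ m := hi'
      linarith
    -- The ratio of consecutive Vandermonde terms is `(i + 1)(k - j) / ((m - i)(j + 1))`. Numerator
    -- minus denominator is the deviation less `m - i + j`, so at least `ε / 4 * (m * k)` by `hmk`,
    -- while the denominator is at most `2 * m * k`.
    have hratio : (1 + ε / 16) * ((m - i) * (j + 1)) ≤ ((i + 1) * (k - j) : ℝ) := by
      have h1 : ((m - i) * (j + 1) : ℝ) ≤ (m * (2 * k)) := by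
        apply mul_le_mul _ _ (by positivity) (by positivity)
        · linarith [(Nat.cast_nonneg i : (0 : ℝ) ≤ i)]
        · linarith
      have h2 : ε / 16 * ((m - i) * (j + 1) : ℝ) ≤ ε / 16 * (m * (2 * k)) :=
        mul_le_mul_of_nonneg_left h1 (by positivity)
      nlinarith [(Nat.cast_nonneg i : (0 : ℝ) ≤ i)]
    have hP : (0 : ℝ) < (m - i) * (j + 1) := by positivity
    have hA : (0 : ℝ) ≤ m.choose (i + 1) * k.choose j := by positivity
    refine le_of_mul_le_mul_right ?_ hP
    calc (m.choose (i + 1) * k.choose j : ℝ) * (1 + ε / 16) * ((m - i) * (j + 1))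
        = (m.choose (i + 1) * k.choose j : ℝ) * ((1 + ε / 16) * ((m - i) * (j + 1))) := by ring
      _ ≤ (m.choose (i + 1) * k.choose j : ℝ) * ((i + 1) * (k - j)) :=
          mul_le_mul_of_nonneg_left hratio hA
      _ = (m.choose (i + 1) * (i + 1)) * (k.choose j * (k - j)) := by ring
      _ = (m.choose i * (m - i)) * (k.choose (j + 1) * (j + 1)) := by rw [e1, e2]
      _ = _ := by ring

theorem choose_mul_choose_mul_pow_le_abs {m k : ℕ} {ε : ℝ} (hε : 0 < ε)
    (hmk : (m + k + 1 : ℝ) ≤ ε / 4 * (m * k)) (hm : 1 ≤ m) (hk : 1 ≤ k) {t i j : ℕ}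
    (hi : i ≤ m) (hj : j ≤ k) (h : ε / 2 * (m * k) + t * (m + k) ≤ |(i * k - j * m : ℝ)|) :
    (m.choose i * k.choose j : ℝ) * (1 + ε / 16) ^ t ≤ (m + k).choose (i + j) := by
  rcases le_abs.1 h with h | h
  · exact choose_mul_choose_mul_pow_le hε hmk hm hk t i j hi hj h
  · have := choose_mul_choose_mul_pow_le (m := k) (k := m) hε (by linarith) hk hm t j i hj hi
      (by linarith)
    rw [add_comm k, add_comm j] at this
    linarith

/-- Both sides are the multinomial coefficient of four classes of sizes `i, j, i', j'`: split first
by the cut and then by sample, or the other way round. -/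
theorem choose_trinomial (i j i' j' : ℕ) :
    (i + j).choose j * (i' + j').choose j' * (i + i' + (j + j')).choose (i + j) =
      (i + i' + (j + j')).choose (j + j') * ((i + i').choose i * (j + j').choose j) := by
  have h1 := Nat.add_choose_mul_factorial_mul_factorial i j
  have h2 := Nat.add_choose_mul_factorial_mul_factorial i' j'
  have h3 := Nat.add_choose_mul_factorial_mul_factorial (i + j) (i' + j')
  have h4 := Nat.add_choose_mul_factorial_mul_factorial (i + i') (j + j')
  have h5 := Nat.add_choose_mul_factorial_mul_factorial i i'
  have h6 := Nat.add_choose_mul_factorial_mul_factorial j j'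
  rw [← Nat.choose_symm_add] at h3 h5 h6
  rw [show i + j + (i' + j') = i + i' + (j + j') by ring] at h3
  have hne : i.factorial * j.factorial * (i'.factorial * j'.factorial) ≠ 0 := by positivity
  refine Nat.eq_of_mul_eq_mul_right (Nat.pos_of_ne_zero hne) ?_
  calc _ = (i + i' + (j + j')).choose (i + j) * ((i + j).choose j * i.factorial * j.factorial) *
        ((i' + j').choose j' * i'.factorial * j'.factorial) := by ring
    _ = (i + i' + (j + j')).choose (j + j') * ((i + i').choose i * i.factorial * i'.factorial) *
        ((j + j').choose j * j.factorial * j'.factorial) := by rw [h1, h2, h5, h6, h3, h4]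
    _ = _ := by ring

/-- An exponential outgrows a polynomial. -/
theorem eventually_mul_pow_le_pow (K Q r : ℝ) (hr : 1 < r) :
    ∀ᶠ t : ℕ in atTop, K * (Q * (t + 1)) ^ 8 ≤ r ^ t := by
  have h1 : Tendsto (fun n : ℕ => (n : ℝ) ^ 8 / r ^ n) atTop (𝓝 0) :=
    tendsto_pow_const_div_const_pow_of_one_lt 8 hr
  have h2 := ((h1.comp (tendsto_add_atTop_nat 1)).const_mul (K * Q ^ 8 * r))
  rw [mul_zero] at h2
  filter_upwards [h2.eventually (gt_mem_nhds one_pos)] with t ht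
  have hp : 0 < r ^ (t + 1) := by positivity
  simp only [Function.comp, Nat.cast_add, Nat.cast_one] at ht
  rw [← mul_div_assoc, div_lt_one hp, pow_succ r] at ht
  have hr0 : 0 < r := by linarith
  refine le_of_mul_le_mul_right ?_ hr0
  rw [mul_pow]
  linarith

/-! ### The words of a joint sample that is cut by a lower set -/

/-- Once `P` fails along the list it fails for good, so the two filtered lists are a prefix and the
complementary suffix. -/
theorem filter_append_filter_not_of_pairwise {β : Type*} (P : β → Prop) [DecidablePred P] (l : List β)
    (h : l.Pairwise fun a b => P b → P a) : l.filter P ++ l.filter (fun b => ¬ P b) = l := by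
  induction l with
  | nil => rfl
  | cons a l ih =>
    rw [List.pairwise_cons] at h
    by_cases ha : P a
    · have e1 : (a :: l).filter P = a :: l.filter P := List.filter_cons_of_pos (by simpa using ha)
      have e2 : (a :: l).filter (fun b => ¬ P b) = l.filter fun b => ¬ P b :=
        List.filter_cons_of_neg (by simpa using ha)
      rw [e1, e2, List.cons_append, ih h.2]
    · have hl : ∀ b ∈ l, ¬ P b := fun b hb hPb => ha (h.1 b hb hPb)
      have e1 : l.filter (fun b => P b) = [] := by simpa [List.filter_eq_nil_iff] using hl
      have e2 : l.filter (fun b => ¬ P b) = l := by simpa [List.filter_eq_self] using hl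
      simp only [List.filter_cons, ha, decide_false, not_false_eq_true, decide_true, if_true, e1, e2]
      rfl

theorem countP_ofFn_equiv {β : Type*} [Fintype β] {n : ℕ} (σ : Fin n ≃ β) (P : β → Prop)
    [DecidablePred P] : (List.ofFn σ).countP P = (Finset.univ.filter P).card := by
  have h : ((List.ofFn σ : List β) : Multiset β) = Finset.univ.val := by
    have hn : (List.ofFn σ).Nodup := List.nodup_ofFn.2 σ.injective
    have := Finset.eq_univ_of_forall (s := ⟨((List.ofFn σ : List β) : Multiset β), hn⟩)
      (fun b => Multiset.mem_coe.2 (List.mem_ofFn.2 (σ.surjective b)))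
    exact congrArg Finset.val this
  rw [← Multiset.coe_countP, h, Finset.card, Finset.filter_val, Multiset.countP_eq_card_filter]

/-- The number of elements of a sample in the set `H`. -/
noncomputable def hits {E : Type*} (H : Set E) {m : ℕ} (x : Fin m → E) : ℕ :=
  open Classical in (Finset.univ.filter fun i => x i ∈ H).card

theorem hits_eq_card {E : Type*} (H : Set E) {m : ℕ} (x : Fin m → E)
    [DecidablePred fun i => x i ∈ H] : hits H x = (Finset.univ.filter fun i => x i ∈ H).card := by
  unfold hits
  congr

theorem hits_le {E : Type*} (H : Set E) {m : ℕ} (x : Fin m → E) : hits H x ≤ m := by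
  classical
  simpa [hits_eq_card] using Finset.card_filter_le (Finset.univ : Finset (Fin m)) fun i => x i ∈ H

theorem card_filter_sum {m k : ℕ} (P : Fin m ⊕ Fin k → Prop) [DecidablePred P] :
    (Finset.univ.filter P).card = (Finset.univ.filter fun i => P (Sum.inl i)).card +
      (Finset.univ.filter fun i => P (Sum.inr i)).card := by
  simp only [← Fintype.card_subtype]
  rw [Fintype.card_congr (Equiv.subtypeSum (p := P)), Fintype.card_sum]

theorem hits_compl {E : Type*} (H : Set E) {m : ℕ} (x : Fin m → E) :
    hits Hᶜ x = m - hits H x := by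
  classical
  have h := Finset.card_filter_add_card_filter_not (s := (Finset.univ : Finset (Fin m)))
    (fun i => x i ∈ H)
  simp only [hits_eq_card, Set.mem_compl_iff]
  rw [Finset.card_univ, Fintype.card_fin] at h
  omega

/-- If `H` is a lower set in the order of the sample elements, then a word of the joint sample is the
concatenation of a word of the elements in `H` and a word of the other elements. -/
theorem exists_append_of_mem_jointWords {E S : Type*} [LinearOrder S] (τ : E → S) (H : Set E)
    (hH : ∀ x y, τ x ≤ τ y → y ∈ H → x ∈ H) {m k : ℕ} (x : Fin m → E) (y : Fin k → E)
    {A : List Bool} (hA : A ∈ jointWords (fun i => τ (x i)) (fun i => τ (y i))) :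
    ∃ u v : List Bool, A = u ++ v ∧ u.length = hits H x + hits H y ∧ u.count true = hits H y ∧
      v.length = (m - hits H x) + (k - hits H y) ∧ v.count true = k - hits H y := by
  classical
  simp only [jointWords, orderings, Finset.mem_image, Finset.mem_filter, Finset.mem_univ,
    true_and] at hA
  obtain ⟨σ, hσ, rfl⟩ := hA
  -- The counts hold for any set; they are used for `H` and for its complement.
  have hcut : ∀ H' : Set E,
      (((List.ofFn σ).filter fun z => Sum.elim x y z ∈ H').map Sum.isRight).length =
        hits H' x + hits H' y ∧
      (((List.ofFn σ).filter fun z => Sum.elim x y z ∈ H').map Sum.isRight).count true =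
        hits H' y := by
    intro H'
    constructor
    · rw [List.length_map, ← List.countP_eq_length_filter, countP_ofFn_equiv, card_filter_sum]
      simp only [Sum.elim_inl, Sum.elim_inr, hits_eq_card]
      congr
    · rw [List.count, List.countP_map, List.countP_filter]
      have := countP_ofFn_equiv σ fun z => z.isRight = true ∧ Sum.elim x y z ∈ H'
      rw [card_filter_sum] at this
      simp only [Sum.isRight_inl, Bool.false_eq_true, false_and, Finset.filter_false,
        Finset.card_empty, zero_add, Sum.isRight_inr, true_and, Sum.elim_inr] at this
      rw [hits_eq_card, ← this]
      congr 1
      ext z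
      simp
  refine ⟨_, ((List.ofFn σ).filter fun z => Sum.elim x y z ∈ Hᶜ).map Sum.isRight, ?_,
    (hcut H).1, (hcut H).2, ?_, ?_⟩
  · rw [← List.map_append]
    have := filter_append_filter_not_of_pairwise (fun z => Sum.elim x y z ∈ H) (List.ofFn σ) ?_
    · simp only [Set.mem_compl_iff]
      rw [this, List.map_ofFn]
      rfl
    · rw [List.pairwise_ofFn]
      intro p q hpq hq
      refine hH _ _ ?_ hq
      have h1 := hσ hpq.le
      have h2 : ∀ z, Sum.elim (fun i => τ (x i)) (fun i => τ (y i)) z = τ (Sum.elim x y z) := by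
        rintro (z | z) <;> rfl
      simpa only [h2] using h1
  · have h := (hcut Hᶜ).1
    rw [hits_compl, hits_compl] at h
    convert h
  · have h := (hcut Hᶜ).2
    rw [hits_compl] at h
    convert h

/-! ### The law of large numbers for hits -/

/-- Chebyshev's inequality; a variable with values in `[0, 1]` has variance at most `1 / 4`. -/
theorem measure_pi_hits_le {E : Type*} [MeasurableSpace E] (F : Measure E) [IsProbabilityMeasure F]
    {H : Set E} (hH : MeasurableSet H) {m : ℕ} (hm : 0 < m) {η : ℝ} (hη : 0 < η) :
    Measure.pi (fun _ : Fin m => F) {x | η * m ≤ |(hits H x : ℝ) - m * F.real H|} ≤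
      ENNReal.ofReal (1 / (4 * η ^ 2) / m) := by
  classical
  have hm' : (0 : ℝ) < m := by exact_mod_cast hm
  let X : E → ℝ := H.indicator 1
  have hXm : Measurable X := measurable_one.indicator hH
  have hX01 : ∀ z, X z ∈ Set.Icc (0 : ℝ) 1 := fun z => by
    by_cases hz : z ∈ H <;> simp [X, hz]
  have hX2 : MemLp X 2 F := memLp_of_bounded (.of_forall hX01) hXm.aestronglyMeasurable 2
  let S : (Fin m → E) → ℝ := ∑ i, fun x => X (x i)
  have hS : ∀ x, S x = hits H x := fun x => by
    simp [S, X, hits_eq_card, Finset.sum_apply, Set.indicator_apply]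
  have hcomp : ∀ i : Fin m, MemLp (fun x : Fin m → E => X (x i)) 2 (Measure.pi fun _ => F) :=
    fun i => hX2.comp_measurePreserving (measurePreserving_eval _ i)
  have hS2 : MemLp S 2 (Measure.pi fun _ : Fin m => F) := memLp_finsetSum' _ fun i _ => hcomp i
  have hmean : ∫ x, S x ∂(Measure.pi fun _ : Fin m => F) = m * F.real H := by
    simp only [S, Finset.sum_apply]
    rw [integral_finsetSum _ fun i _ => (hcomp i).integrable one_le_two]
    have : ∀ i : Fin m, ∫ x : Fin m → E, X (x i) ∂(Measure.pi fun _ => F) = F.real H := fun i => by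
      rw [integral_comp_eval (μ := fun _ : Fin m => F) hXm.aestronglyMeasurable]
      exact integral_indicator_one hH
    simp [this]
  have hvar : ProbabilityTheory.variance S (Measure.pi fun _ : Fin m => F) ≤ m * (1 / 4) := by
    simp only [S]
    rw [ProbabilityTheory.variance_sum_pi (X := fun _ : Fin m => X) fun _ => hX2]
    have := ProbabilityTheory.variance_le_sq_of_bounded (μ := F) (.of_forall hX01) hXm.aemeasurable
    refine (Finset.sum_le_sum fun _ _ => this).trans_eq ?_
    simp
    norm_num
  have hcheb := ProbabilityTheory.meas_ge_le_variance_div_sq hS2 (c := η * m) (by positivity)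
  rw [hmean] at hcheb
  simp only [hS] at hcheb
  refine hcheb.trans (ENNReal.ofReal_le_ofReal ?_)
  rw [div_le_iff₀ (by positivity)]
  refine hvar.trans_eq ?_
  field_simp

/-! ### Lower sets separate distributions -/

/-- The first difference of the sequences lies inside the prefix and decides its order, or lies
beyond and the prefixes coincide. -/
theorem initial_segment_mono (M : ℕ) {f g : Lex (ℕ → ℤ)} (h : f ≤ g) :
    (toLex fun i : Fin M => ofLex f i) ≤ toLex fun i : Fin M => ofLex g i := by
  rcases h.lt_or_eq with h | rfl
  · obtain ⟨n, heq, hlt⟩ := h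
    by_cases hn : n < M
    · exact le_of_lt ⟨⟨n, hn⟩, fun j hj => heq j hj, hlt⟩
    · refine le_of_eq (congrArg toLex (funext fun i => heq i ?_))
      exact lt_of_lt_of_le i.2 (not_lt.1 hn)
  · exact le_rfl

theorem measurable_binaryExpansion (j : ℕ) : Measurable fun r => binaryExpansion r j := by
  cases j with
  | zero => exact Int.measurable_floor
  | succ j =>
    have h : Measurable fun r : ℝ => ⌊Int.fract r * ((2 : ℕ) : ℝ) ^ (j + 1)⌋₊ :=
      Nat.measurable_floor.comp (measurable_fract.mul_const _)
    exact (measurable_from_top (f := fun n : ℕ => (((Fin.ofNat 2 n : Fin 2) : ℕ) : ℤ))).comp h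

theorem binaryExpansion_injective : Function.Injective binaryExpansion := by
  intro r s h
  have h0 : ⌊r⌋ = ⌊s⌋ := congrFun h 0
  have hd : Real.digits (Int.fract r) 2 = Real.digits (Int.fract s) 2 := by
    funext j
    have hj : ((Real.digits (Int.fract r) 2 j : ℕ) : ℤ) = (Real.digits (Int.fract s) 2 j : ℕ) :=
      congrFun h (j + 1)
    exact Fin.ext (by exact_mod_cast hj)
  have hf : Int.fract r = Int.fract s := by
    rw [← Real.ofDigits_digits one_lt_two ⟨Int.fract_nonneg r, Int.fract_lt_one r⟩, hd,
      Real.ofDigits_digits one_lt_two ⟨Int.fract_nonneg s, Int.fract_lt_one s⟩]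
  rw [← Int.floor_add_fract r, ← Int.floor_add_fract s, h0, hf]

theorem interleave_injective (d : ℕ) [NeZero d] : Function.Injective (interleave d) := by
  intro x y h
  funext i
  refine binaryExpansion_injective (funext fun j => ?_)
  -- Entry `j` of component `i` stands in position `i + d * j`.
  have hn := congrFun (congrArg ofLex h) (i + d * j)
  have hd : 0 < d := Nat.pos_of_ne_zero (NeZero.ne d)
  have hi : Fin.ofNat d (i + d * j) = i := Fin.ext (by simp [Fin.ofNat, Nat.mod_eq_of_lt i.2])
  have hj : (i + d * j) / d = j := by
    rw [Nat.add_mul_div_left _ _ hd, Nat.div_eq_of_lt i.2, zero_add]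
  simpa only [interleave, ofLex_toLex, hi, hj] using hn

theorem measurable_ofLex_interleave (d : ℕ) [NeZero d] :
    Measurable fun x : Fin d → ℝ => ofLex (interleave d x) :=
  measurable_pi_lambda _ fun n =>
    (measurable_binaryExpansion (n / d)).comp (measurable_pi_apply (Fin.ofNat d n))

/-- Measures on integer sequences are determined by the laws of the prefixes. -/
theorem measure_ext_of_initial_segments {μ ν : Measure (ℕ → ℤ)} [IsFiniteMeasure μ]
    (h : ∀ M : ℕ, μ.map (fun f (i : Fin M) => f i) = ν.map fun f (i : Fin M) => f i) : μ = ν := by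
  have hlim : IsProjectiveLimit μ fun J => μ.map J.restrict := fun J => rfl
  refine hlim.unique fun J => ?_
  obtain ⟨M, hM⟩ := J.exists_nat_subset_range
  let g : (Fin M → ℤ) → (J → ℤ) := fun f j => f ⟨j, Finset.mem_range.1 (hM j.2)⟩
  have hg : Measurable g := by fun_prop
  have hp : Measurable fun (f : ℕ → ℤ) (i : Fin M) => f i := by fun_prop
  have hJ : (J.restrict : (ℕ → ℤ) → (J → ℤ)) = g ∘ fun f (i : Fin M) => f i := rfl
  change ν.map J.restrict = μ.map J.restrict
  rw [hJ, ← Measure.map_map hg hp, ← Measure.map_map hg hp, h M]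

/-- If the measures agreed on measurable lower sets, they would agree on the event that a prefix
equals `c`, the difference of the lower sets "prefix at most `c`" and "prefix below `c`". There are
countably many prefixes of each length, so all prefix laws, and then the measures, would coincide.
-/
theorem exists_lower_set_interleave (d : ℕ) [NeZero d] (μ ν : Measure (Fin d → ℝ))
    [IsProbabilityMeasure μ] [IsProbabilityMeasure ν] (hne : μ ≠ ν) :
    ∃ H, MeasurableSet H ∧ (∀ x y, interleave d x ≤ interleave d y → y ∈ H → x ∈ H) ∧ μ H ≠ ν H := by
  by_contra! hcon
  refine hne ?_
  have hT := measurable_ofLex_interleave d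
  -- An injective measurable map between standard Borel spaces is an embedding (Lusin–Souslin), so
  -- equality of the image laws pulls back.
  have hemb : MeasurableEmbedding fun x : Fin d → ℝ => ofLex (interleave d x) :=
    hT.measurableEmbedding (ofLex.injective.comp (interleave_injective d))
  have hmap : μ.map (fun x => ofLex (interleave d x)) = ν.map fun x => ofLex (interleave d x) := by
    have : IsFiniteMeasure (μ.map fun x => ofLex (interleave d x)) :=
      Measure.isFiniteMeasure_map _ _
    refine measure_ext_of_initial_segments fun M => ?_
    have hp : Measurable fun (f : ℕ → ℤ) (i : Fin M) => f i := by fun_prop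
    rw [Measure.map_map hp hT, Measure.map_map hp hT]
    have hpT := hp.comp hT
    refine Measure.ext_of_singleton fun c => ?_
    rw [Measure.map_apply hpT (measurableSet_singleton c),
      Measure.map_apply hpT (measurableSet_singleton c)]
    let P : (Fin d → ℝ) → Lex (Fin M → ℤ) := fun x => toLex fun i => ofLex (interleave d x) i
    have hP : ∀ s : Set (Lex (Fin M → ℤ)), MeasurableSet (P ⁻¹' s) := fun s =>
      hpT (Set.to_countable (toLex ⁻¹' s)).measurableSet
    have hPm : ∀ x y, interleave d x ≤ interleave d y → P x ≤ P y := fun x y => initial_segment_mono M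
    have h1 := hcon (P ⁻¹' Set.Iic (toLex c)) (hP _) fun x y hxy hy => (hPm x y hxy).trans hy
    have h2 := hcon (P ⁻¹' Set.Iio (toLex c)) (hP _) fun x y hxy hy => (hPm x y hxy).trans_lt hy
    have hdiff : ((fun (f : ℕ → ℤ) (i : Fin M) => f i) ∘ fun x => ofLex (interleave d x)) ⁻¹' {c} =
        P ⁻¹' Set.Iic (toLex c) \ P ⁻¹' Set.Iio (toLex c) := by
      rw [← Set.preimage_sdiff, Set.Iic_sdiff_Iio_same]
      rfl
    have hsub : P ⁻¹' Set.Iio (toLex c) ⊆ P ⁻¹' Set.Iic (toLex c) :=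
      Set.preimage_mono Set.Iio_subset_Iic_self
    rw [hdiff, measure_sdiff hsub (hP _).nullMeasurableSet (measure_ne_top _ _),
      measure_sdiff hsub (hP _).nullMeasurableSet (measure_ne_top _ _), h1, h2]
  rw [← hemb.comap_map μ, hmap, hemb.comap_map ν]

theorem exists_lower_set_real (μ ν : Measure ℝ) [IsProbabilityMeasure μ] (hne : μ ≠ ν) :
    ∃ H, MeasurableSet H ∧ (∀ x y : ℝ, id x ≤ id y → y ∈ H → x ∈ H) ∧ μ H ≠ ν H := by
  by_contra! hcon
  exact hne (Measure.ext_of_Iic μ ν fun t =>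
    hcon (Set.Iic t) measurableSet_Iic fun x y hxy hy => le_trans hxy hy)

/-! ### Consistency of the test -/

theorem exists_length_append_le {ζ : List Bool →. List Bool} (hζ : IsOptimalMachine ζ)
    {φ : List Bool → List Bool} (hφ : IsIdealCode ζ φ) :
    ∃ c : ℕ, ∀ u v : List Bool, 2 ^ (φ (u ++ v)).length ≤
      2 ^ c * (8 * (u.length.choose (u.count true) * v.length.choose (v.count true)) *
        (u.length + v.length + 1) ^ 8) := by
  obtain ⟨c₁, hc₁⟩ := exists_complexity_append_le hζ
  obtain ⟨c₂, hc₂⟩ := hφ.2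
  refine ⟨c₁ + c₂, fun u v => ?_⟩
  obtain ⟨L, hL, hcomp⟩ := hc₁ u v
  have h : (φ (u ++ v)).length ≤ c₁ + c₂ + L := by
    have h1 : ((φ (u ++ v)).length : ℕ∞) ≤ ((L + c₁ + c₂ : ℕ) : ℕ∞) := by
      refine (hc₂ (u ++ v)).trans ?_
      push_cast
      gcongr
    have h2 : (φ (u ++ v)).length ≤ L + c₁ + c₂ := by exact_mod_cast h1
    omega
  calc 2 ^ (φ (u ++ v)).length ≤ 2 ^ (c₁ + c₂ + L) := Nat.pow_le_pow_right two_pos h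
    _ = 2 ^ (c₁ + c₂) * 2 ^ L := pow_add _ _ _
    _ ≤ _ := Nat.mul_le_mul_left _ hL

/-- By `choose_trinomial`, the fraction of words with the given cut equals the fraction of
Vandermonde's sum carried by one term, so the exponential gain transfers. -/
theorem choose_mul_choose_mul_pow_le_choose {m k t i j : ℕ} {r : ℝ} (hi : i ≤ m) (hj : j ≤ k)
    (h : (m.choose i * k.choose j : ℝ) * r ^ t ≤ (m + k).choose (i + j)) :
    ((i + j).choose j * (m - i + (k - j)).choose (k - j) : ℝ) * r ^ t ≤ (m + k).choose k := by
  obtain ⟨i', rfl⟩ := Nat.exists_eq_add_of_le hi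
  obtain ⟨j', rfl⟩ := Nat.exists_eq_add_of_le hj
  rw [Nat.add_sub_cancel_left, Nat.add_sub_cancel_left]
  have htri : ((i + j).choose j * (i' + j').choose j' * (i + i' + (j + j')).choose (i + j) : ℝ) =
      (i + i' + (j + j')).choose (j + j') * ((i + i').choose i * (j + j').choose j) := by
    exact_mod_cast choose_trinomial i j i' j'
  have hpos : (0 : ℝ) < (i + i' + (j + j')).choose (i + j) := by
    exact_mod_cast Nat.choose_pos (by omega)
  refine le_of_mul_le_mul_right ?_ hpos
  calc _ = ((i + j).choose j * (i' + j').choose j' * (i + i' + (j + j')).choose (i + j) : ℝ) *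
        r ^ t := by ring
    _ = (i + i' + (j + j')).choose (j + j') *
        (((i + i').choose i * (j + j').choose j) * r ^ t) := by rw [htri]; ring
    _ ≤ _ := mul_le_mul_of_nonneg_left h (Nat.cast_nonneg _)

theorem rejects_iff {φ : List Bool → List Bool} {α : ℝ} (hα : 0 < α) (m k : ℕ) (A : List Bool) :
    Rejects φ α m k A ↔ (2 : ℝ) ^ (φ A).length ≤ α * (m + k).choose k := by
  have hN : ((m + k).factorial : ℝ) / ((m.factorial : ℝ) * (k.factorial : ℝ)) =
      (m + k).choose k := by
    rw [div_eq_iff (by positivity), ← mul_assoc]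
    exact_mod_cast (Nat.add_choose_mul_factorial_mul_factorial m k).symm
  have hpos : (0 : ℝ) < (m + k).choose k := by exact_mod_cast Nat.choose_pos (by omega)
  rw [Rejects, hN, Real.le_logb_iff_rpow_le one_lt_two (by positivity), Real.rpow_natCast]

theorem mul_poly_le {C R M Q r α : ℝ} (hα : 0 < α) (hC : 0 ≤ C) (hR : 0 ≤ R) (hM : 0 ≤ M)
    (hMQ : M ≤ Q) (h : C * 8 / α * Q ^ 8 ≤ r) : C * (8 * R * M ^ 8) ≤ α * (R * r) := by
  have h1 : C * 8 / α * M ^ 8 ≤ r :=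
    (mul_le_mul_of_nonneg_left (pow_le_pow_left₀ hM hMQ 8) (by positivity)).trans h
  rw [div_mul_eq_mul_div, div_le_iff₀ hα] at h1
  calc C * (8 * R * M ^ 8) = R * (C * 8 * M ^ 8) := by ring
    _ ≤ R * (r * α) := mul_le_mul_of_nonneg_left h1 hR
    _ = _ := by ring

/-- Words that are far from proportional on the two sides of a cut are rejected. -/
theorem exists_rejects_append {ζ : List Bool →. List Bool} (hζ : IsOptimalMachine ζ)
    {φ : List Bool → List Bool} (hφ : IsIdealCode ζ φ) {α a η : ℝ} (hα : 0 < α) (ha : 0 < a)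
    (hη : 0 < η) :
    ∃ n₀ : ℕ, ∀ m k : ℕ, n₀ ≤ k → k ≤ m → a * m ≤ k → ∀ i j : ℕ, i ≤ m → j ≤ k →
      2 * η * (m * k) ≤ |(i * k - j * m : ℝ)| → ∀ u v : List Bool,
        u.length = i + j → u.count true = j → v.length = (m - i) + (k - j) → v.count true = k - j →
          Rejects φ α m k (u ++ v) := by
  obtain ⟨c, hc⟩ := exists_length_append_le hζ hφ
  have hev := eventually_mul_pow_le_pow (2 ^ c * 8 / α) (6 / (a * η)) (1 + 2 * η / 16)
    (by linarith [hη])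
  obtain ⟨t₀, ht₀⟩ := eventually_atTop.1 hev
  -- The first bound makes `t ≥ t₀` below; the second gives `m + k + 1 ≤ 3 * m ≤ η / 2 * (m * k)`.
  obtain ⟨n₀, hn₀⟩ := exists_nat_ge (max (2 * t₀ / η) (max (6 / η) 1))
  refine ⟨n₀, fun m k hnk hkm hak i j hi hj hgap u v hu hu' hv hv' => ?_⟩
  have hn₀k : (n₀ : ℝ) ≤ k := by exact_mod_cast hnk
  have hk1 : 2 * t₀ / η ≤ (k : ℝ) := (le_max_left _ _).trans (hn₀.trans hn₀k)
  have hk2 : 6 / η ≤ (k : ℝ) :=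
    (le_max_left _ _).trans ((le_max_right _ _).trans (hn₀.trans hn₀k))
  have hk3 : (1 : ℝ) ≤ k := (le_max_right _ _).trans ((le_max_right _ _).trans (hn₀.trans hn₀k))
  have hkm' : (k : ℝ) ≤ m := by exact_mod_cast hkm
  rw [div_le_iff₀ hη] at hk1 hk2
  -- Since `k ≤ m`, `t` steps use at most `t * (2 * m) ≤ η * (m * k)`, half of the deviation; the
  -- other half is the margin `ε / 2 * (m * k)` with `ε = 2 * η`.
  set t := ⌊η * k / 2⌋₊ with ht
  have ht1 : (t : ℝ) ≤ η * k / 2 := Nat.floor_le (by positivity)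
  have ht2 : η * k / 2 < t + 1 := Nat.lt_floor_add_one _
  have htt₀ : t₀ ≤ t := Nat.le_floor (by linarith)
  have hm0 : (0 : ℝ) < m := by linarith
  have hprob := choose_mul_choose_mul_pow_le_abs (m := m) (k := k) (ε := 2 * η) (t := t)
    (by positivity) (by nlinarith) (by exact_mod_cast hk3.trans hkm') (by exact_mod_cast hk3) hi hj
    (le_trans (by nlinarith) hgap)
  have hfrac := choose_mul_choose_mul_pow_le_choose hi hj hprob
  have hexp := ht₀ t htt₀
  have hlen := hc u v
  rw [hu, hu', hv, hv'] at hlen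
  have hsum : i + j + (m - i + (k - j)) = m + k := by omega
  rw [hsum] at hlen
  have hlen' : (2 : ℝ) ^ (φ (u ++ v)).length ≤ 2 ^ c *
      (8 * ((i + j).choose j * (m - i + (k - j)).choose (k - j)) * (m + k + 1) ^ 8) := by
    exact_mod_cast hlen
  rw [rejects_iff hα]
  -- The word length is linear in the number of steps: `m + k + 1 ≤ 3 * m ≤ 3 * k / a` and `k < 2 *
  -- (t + 1) / η`.
  have hn : (m + k + 1 : ℝ) ≤ 6 / (a * η) * (t + 1) := by
    rw [div_mul_eq_mul_div, le_div_iff₀ (by positivity)]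
    have h1 : (m + k + 1 : ℝ) * a ≤ 3 * k :=
      (mul_le_mul_of_nonneg_right (by linarith : (m + k + 1 : ℝ) ≤ 3 * m) ha.le).trans (by linarith)
    have h2 := mul_le_mul_of_nonneg_right h1 hη.le
    linarith
  exact (hlen'.trans (mul_poly_le hα (by positivity) (by positivity) (by positivity) hn hexp)).trans
    (mul_le_mul_of_nonneg_left hfrac hα.le)

/-- The main term `m * k * (p - q)` is at least `4 * η * (m * k)` in size, and each of the two
errors costs at most `η * (m * k)`. -/
theorem abs_sub_ge_of_near {p q η m k x y : ℝ} (hpq : 4 * η ≤ |p - q|) (hm : 0 < m) (hk : 0 < k)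
    (hx : |x - m * p| < η * m) (hy : |y - k * q| < η * k) :
    2 * η * (m * k) ≤ |x * k - y * m| := by
  rw [abs_lt] at hx hy
  have hx1 : (x - m * p) * k ≤ η * m * k := mul_le_mul_of_nonneg_right hx.2.le hk.le
  have hx2 : -(η * m) * k ≤ (x - m * p) * k := mul_le_mul_of_nonneg_right hx.1.le hk.le
  have hy1 : (y - k * q) * m ≤ η * k * m := mul_le_mul_of_nonneg_right hy.2.le hm.le
  have hy2 : -(η * k) * m ≤ (y - k * q) * m := mul_le_mul_of_nonneg_right hy.1.le hm.le
  have hmk : 0 < m * k := mul_pos hm hk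
  rcases le_abs.1 hpq with h | h
  · refine le_abs.2 (Or.inl ?_)
    nlinarith [mul_le_mul_of_nonneg_right h hmk.le]
  · refine le_abs.2 (Or.inr ?_)
    nlinarith [mul_le_mul_of_nonneg_right h hmk.le]

/-- If almost-typical samples lead to rejection, the test accepts with the probability of atypical
samples at most. -/
theorem acceptProb_le {E S : Type*} [MeasurableSpace E] [LinearOrder S] (τ : E → S) {H : Set E}
    (hH : MeasurableSet H) {φ : List Bool → List Bool} {α η : ℝ} (hη : 0 < η) (FX FY : Measure E)
    [IsProbabilityMeasure FX] [IsProbabilityMeasure FY] {m k : ℕ} (hm : 0 < m) (hk : 0 < k)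
    (hrej : ∀ (x : Fin m → E) (y : Fin k → E), |(hits H x : ℝ) - m * FX.real H| < η * m →
      |(hits H y : ℝ) - k * FY.real H| < η * k →
        ∀ A ∈ jointWords (fun i => τ (x i)) (fun i => τ (y i)), Rejects φ α m k A) :
    acceptProb τ φ α FX FY m k ≤
      ENNReal.ofReal (1 / (4 * η ^ 2) / m) + ENNReal.ofReal (1 / (4 * η ^ 2) / k) := by
  set BX := {x : Fin m → E | η * m ≤ |(hits H x : ℝ) - m * FX.real H|} with hBX
  set BY := {y : Fin k → E | η * k ≤ |(hits H y : ℝ) - k * FY.real H|} with hBY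
  set P := (Measure.pi fun _ : Fin m => FX).prod (Measure.pi fun _ : Fin k => FY)
  have hle : ∀ s : (Fin m → E) × (Fin k → E),
      (wordLaw (fun i => τ (s.1 i)) (fun i => τ (s.2 i))).toOuterMeasure {A | ¬ Rejects φ α m k A} ≤
        (BX ×ˢ Set.univ ∪ Set.univ ×ˢ BY).indicator 1 s := by
    intro s
    by_cases hs : s ∈ BX ×ˢ Set.univ ∪ Set.univ ×ˢ BY
    · rw [Set.indicator_of_mem hs, Pi.one_apply]
      refine (measure_mono (Set.subset_univ _)).trans_eq ?_
      rw [PMF.toOuterMeasure_apply_eq_one_iff]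
      exact Set.subset_univ _
    · rw [Set.indicator_of_notMem hs, nonpos_iff_eq_zero, PMF.toOuterMeasure_apply_eq_zero_iff]
      simp only [hBX, hBY, Set.mem_union, Set.mem_prod, Set.mem_ofPred_eq, Set.mem_univ, and_true,
        true_and, not_or, not_le] at hs
      rw [Set.disjoint_left]
      intro A hA hA'
      refine hA' (hrej s.1 s.2 hs.1 hs.2 A ?_)
      rwa [wordLaw, PMF.mem_support_uniformOfFinset_iff] at hA
  calc acceptProb τ φ α FX FY m k ≤ ∫⁻ s, (BX ×ˢ Set.univ ∪ Set.univ ×ˢ BY).indicator 1 s ∂P :=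
        lintegral_mono hle
    _ ≤ P (BX ×ˢ Set.univ ∪ Set.univ ×ˢ BY) := lintegral_indicator_one_le _
    _ ≤ P (BX ×ˢ Set.univ) + P (Set.univ ×ˢ BY) := measure_union_le _ _
    _ = Measure.pi (fun _ => FX) BX + Measure.pi (fun _ => FY) BY := by
        simp only [P, Measure.prod_prod, measure_univ, mul_one, one_mul]
    _ ≤ _ := add_le_add (measure_pi_hits_le FX hH hm hη) (measure_pi_hits_le FY hH hk hη)

/-- The common form of the cases `d = 1` and `d > 1`: all that matters about `τ` is a measurable
lower set that separates the distributions. The bounds on `k / m` enter as `a * m ≤ k` and `k ≤ m`.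
-/
theorem tendsto_acceptProb {ζ : List Bool →. List Bool} (hζ : IsOptimalMachine ζ)
    {φ : List Bool → List Bool} (hφ : IsIdealCode ζ φ) {α a b : ℝ} (hα : 0 < α) (ha : 0 < a)
    (hb : b < 1) {E S : Type*} [MeasurableSpace E] [LinearOrder S] (τ : E → S) {H : Set E}
    (hH : MeasurableSet H) (hlow : ∀ x y, τ x ≤ τ y → y ∈ H → x ∈ H) (FX FY : Measure E)
    [IsProbabilityMeasure FX] [IsProbabilityMeasure FY] (hne : FX H ≠ FY H) :
    Tendsto (fun p : ℕ × ℕ => acceptProb τ φ α FX FY p.1 p.2) (sampleSizes a b) (𝓝 0) := by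
  have hreal : FX.real H - FY.real H ≠ 0 := fun h => hne
    ((ENNReal.toReal_eq_toReal_iff' (measure_ne_top _ _) (measure_ne_top _ _)).1 (sub_eq_zero.1 h))
  obtain ⟨η, hη, hη4⟩ : ∃ η : ℝ, 0 < η ∧ 4 * η ≤ |FX.real H - FY.real H| :=
    ⟨|FX.real H - FY.real H| / 4, by have := abs_pos.2 hreal; positivity, by linarith⟩
  obtain ⟨n₀, hn₀⟩ := exists_rejects_append hζ hφ hα ha hη
  have hlim : Tendsto (fun n : ℕ => ENNReal.ofReal (1 / (4 * η ^ 2) / n)) atTop (𝓝 0) := by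
    have := ENNReal.tendsto_ofReal (tendsto_const_div_atTop_nhds_zero_nat (1 / (4 * η ^ 2)))
    rwa [ENNReal.ofReal_zero] at this
  have hsum : Tendsto (fun p : ℕ × ℕ => ENNReal.ofReal (1 / (4 * η ^ 2) / p.1) +
      ENNReal.ofReal (1 / (4 * η ^ 2) / p.2)) (sampleSizes a b) (𝓝 0) := by
    have h := (hlim.comp tendsto_fst).add (hlim.comp tendsto_snd)
    rw [add_zero] at h
    exact h.mono_left inf_le_left
  refine tendsto_of_tendsto_of_tendsto_of_le_of_le' tendsto_const_nhds hsum
    (.of_forall fun _ => zero_le) ?_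
  have hlarge : ∀ᶠ p : ℕ × ℕ in sampleSizes a b, 1 ≤ p.1 ∧ max n₀ 1 ≤ p.2 :=
    Filter.Eventually.filter_mono inf_le_left ((eventually_ge_atTop 1).prod_mk
      (eventually_ge_atTop (max n₀ 1)))
  have hratio : ∀ᶠ p : ℕ × ℕ in sampleSizes a b,
      a < (p.2 : ℝ) / (p.1 : ℝ) ∧ (p.2 : ℝ) / (p.1 : ℝ) < b :=
    Filter.Eventually.filter_mono inf_le_right (eventually_principal.2 fun _ hp => hp)
  filter_upwards [hlarge, hratio] with ⟨m, k⟩ ⟨hm, hk⟩ ⟨hak, hkb⟩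
  have hm0 : (0 : ℝ) < m := by exact_mod_cast hm
  have hk1 : 1 ≤ k := (le_max_right _ _).trans hk
  have hk0 : (0 : ℝ) < k := by exact_mod_cast hk1
  simp only at hak hkb
  rw [lt_div_iff₀ hm0] at hak
  have hkm : (k : ℝ) < m := by simpa using (div_lt_iff₀ hm0).1 (hkb.trans hb)
  refine acceptProb_le τ hH hη FX FY hm hk1 fun x y hx hy A hA => ?_
  obtain ⟨u, v, rfl, hu, hu', hv, hv'⟩ := exists_append_of_mem_jointWords τ H hlow x y hA
  exact hn₀ m k ((le_max_left _ _).trans hk) (by exact_mod_cast hkm.le) hak.le _ _ (hits_le H x)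
    (hits_le H y) (abs_sub_ge_of_near hη4 hm0 hk0 hx hy) u v hu hu' hv hv'

end RankTest

theorem proposition2
    (ζ : List Bool →. List Bool) (hζ : RankTest.IsOptimalMachine ζ)
    (φ : List Bool → List Bool) (hφ : RankTest.IsIdealCode ζ φ)
    (α : ℝ) (hα : 0 < α) (a b : ℝ) (ha : 0 < a) (hab : a < b) (hb : b < 1) :
    (∀ FX FY : Measure ℝ, IsProbabilityMeasure FX → IsProbabilityMeasure FY → FX ≠ FY →
      Tendsto (fun p : ℕ × ℕ => RankTest.acceptProb (id : ℝ → ℝ) φ α FX FY p.1 p.2)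
        (RankTest.sampleSizes a b) (𝓝 0)) ∧
    (∀ (d : ℕ) [NeZero d], 1 < d →
      ∀ FX FY : Measure (Fin d → ℝ), IsProbabilityMeasure FX → IsProbabilityMeasure FY → FX ≠ FY →
        Tendsto (fun p : ℕ × ℕ => RankTest.acceptProb (RankTest.interleave d) φ α FX FY p.1 p.2)
          (RankTest.sampleSizes a b) (𝓝 0)) := by
  constructor
  · intro FX FY _ _ hne
    obtain ⟨H, hH, hlow, hHne⟩ := RankTest.exists_lower_set_real FX FY hne
    exact RankTest.tendsto_acceptProb hζ hφ hα ha hb id hH hlow FX FY hHne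
  · intro d _ _ FX FY _ _ hne
    obtain ⟨H, hH, hlow, hHne⟩ := RankTest.exists_lower_set_interleave d FX FY hne
    exact RankTest.tendsto_acceptProb hζ hφ hα ha hb _ hH hlow FX FY hHne
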